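/- Let $\alpha>0$ be real and, for $0<a<1$, let $$w(x,a)=(1-x^2)^{\alpha}\bigl(1-\chi_{(-a,a)}(x)\bigr),\qquad x\in[-1,1],$$ where $\chi_{(-a,a)}$ is the indicator function of $(-a,a)$. Let $P_n(x,a)$, $n=0,1,2,\ldots$, be the monic polynomials in $x$ of degree $n$ that are orthogonal with respect to this weight, $$\int_{-1}^{1}P_j(x,a)P_k(x,a)w(x,a)\,dx=h_j(a)\delta_{jk},\qquad j,k=0,1,2,\ldots,$$ and put $$R_n(a)=\frac{2P_n(a,a)^2(1-a^2)^{\alpha}}{h_n(a)}.$$ Then for every integer $n\ge 0$ the function $R_n$ is twice differentiable on $(0,1)$ and satisfies there the second-order nonlinear differential equation $$\begin{aligned} &2a(a^2-1)^2 R_n\,(aR_n+2n+2\alpha+1)\left[(a^2-1)R_n+(2n+2\alpha+1)a\right]R_n''\\ &-a(a^2-1)^2\left[3a(a^2-1)R_n^2+2(2a^2-1)(2n+2\alpha+1)R_n+(2n+2\alpha+1)^2a\right](R_n')^2\\ &+2(a^2-1)(2n+2\alpha+1)R_n\left[(2a^4-a^2+1)R_n+2a^3(2n+2\alpha+1)\right]R_n'-a^2(a^2-1)^3R_n^6\\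 &-2a(a^2-1)^2(2a^2-1)(2n+2\alpha+1)R_n^5\\ &-(a^2-1)\Big[a^4(7+24\alpha+24n+24n^2+48n\alpha+24\alpha^2)-a^2(5+24n+24n^2+24\alpha+48n\alpha+20\alpha^2)\\ &\qquad\qquad+2+4\alpha+4n+4n^2+8n\alpha\Big]R_n^4\\ &-4a(a^2-1)(2n+2\alpha+1)\left[a^2(2n+2\alpha+1)^2-2n-2n^2-2\alpha-4n\alpha\right]R_n^3\\ &-4a^2(2n+2\alpha+1)^2\left[(n(n+1)+(2n+1)\alpha+\alpha^2)a^2-n(n+1)-(2n+1)\alpha\right]R_n^2=0, \end{aligned}$$ where $R_n=R_n(a)$ and primes denote derivatives with respect to $a$. -/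

import Mathlib

open scoped Polynomial

noncomputable section

namespace JacobiGap

/-- The weight `w(x,a) = (1 - x²)^α (1 - χ_{(-a,a)}(x))`, used on `[-1,1]`. -/
def weight (α a x : ℝ) : ℝ :=
  (1 - x ^ 2) ^ α * (1 - Set.indicator (Set.Ioo (-a) a) (fun _ => (1 : ℝ)) x)

/-- The pairing `∫_{-1}^{1} p(x) q(x) w(x,a) dx`. -/
def pairing (α a : ℝ) (p q : ℝ[X]) : ℝ :=
  ∫ x in (-1 : ℝ)..1, p.eval x * q.eval x * weight α a x

/-- The monic orthogonal polynomial `P_n(x,a)`, by Gram-Schmidt on the monomials. That it is monic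
of degree `n` and orthogonal is proved in `P_monic`, `natDegree_P`, `pairing_P_of_ne`; uniqueness
is proved in `P_unique`. -/
def P (α a : ℝ) (n : ℕ) : ℝ[X] :=
  Polynomial.X ^ n - ∑ k : Fin n,
    Polynomial.C (pairing α a (Polynomial.X ^ n) (P α a k) / pairing α a (P α a k) (P α a k)) *
      P α a k
termination_by n
decreasing_by all_goals exact k.2

/-- The squared norm `h_n(a) = ∫_{-1}^{1} P_n(x,a)² w(x,a) dx`. -/
def h (α : ℝ) (n : ℕ) (a : ℝ) : ℝ := pairing α a (P α a n) (P α a n)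

/-- `R_n(a) = 2 P_n(a,a)² (1 - a²)^α / h_n(a)`, as a function of `a`. -/
def R (α : ℝ) (n : ℕ) (a : ℝ) : ℝ :=
  2 * (P α a n).eval a ^ 2 * (1 - a ^ 2) ^ α / h α n a

theorem P_eq (α a : ℝ) (n : ℕ) : P α a n = Polynomial.X ^ n - ∑ k : Fin n,
    Polynomial.C (pairing α a (Polynomial.X ^ n) (P α a k) / pairing α a (P α a k) (P α a k)) *
      P α a k := by
  rw [P]

theorem P_monic_natDegree (α a : ℝ) (n : ℕ) : (P α a n).Monic ∧ (P α a n).natDegree = n := by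
  induction n using Nat.strong_induction_on with
  | _ n ih =>
    have hlt : (∑ k : Fin n, Polynomial.C (pairing α a (Polynomial.X ^ n) (P α a k) /
        pairing α a (P α a k) (P α a k)) * P α a k).degree < (n : WithBot ℕ) := by
      refine lt_of_le_of_lt (Polynomial.degree_sum_le _ _) ?_
      refine (Finset.sup_lt_iff (WithBot.bot_lt_coe n)).2 fun k _ => ?_
      rw [← Polynomial.smul_eq_C_mul]
      refine lt_of_le_of_lt (Polynomial.degree_smul_le _ _) ?_
      rw [Polynomial.degree_eq_natDegree (ih k k.2).1.ne_zero, (ih k k.2).2]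
      exact WithBot.coe_lt_coe.2 (Nat.cast_lt.2 k.2)
    rw [P_eq]
    rw [← Polynomial.degree_X_pow (R := ℝ) n] at hlt
    refine ⟨(Polynomial.monic_X_pow n).sub_of_left hlt, ?_⟩
    refine Polynomial.natDegree_eq_of_degree_eq_some ?_
    rw [Polynomial.degree_sub_eq_left_of_degree_lt hlt, Polynomial.degree_X_pow]

theorem P_monic (α a : ℝ) (n : ℕ) : (P α a n).Monic := (P_monic_natDegree α a n).1

theorem natDegree_P (α a : ℝ) (n : ℕ) : (P α a n).natDegree = n := (P_monic_natDegree α a n).2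

theorem intervalIntegrable_mul_weight {α : ℝ} (hα : 0 < α) (a : ℝ) (p q : ℝ[X]) (b c : ℝ) :
    IntervalIntegrable (fun x => p.eval x * q.eval x * weight α a x) MeasureTheory.volume b c := by
  have hf : Continuous fun x : ℝ => p.eval x * q.eval x * (1 - x ^ 2) ^ α :=
    (p.continuous.mul q.continuous).mul
      ((continuous_const.sub (continuous_pow 2)).rpow_const fun _ => Or.inr hα.le)
  have h1 := hf.intervalIntegrable (μ := MeasureTheory.volume) b c
  have h2 : IntervalIntegrable (Set.indicator (Set.Ioo (-a) a)
      fun x : ℝ => p.eval x * q.eval x * (1 - x ^ 2) ^ α) MeasureTheory.volume b c :=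
    ⟨h1.1.indicator measurableSet_Ioo, h1.2.indicator measurableSet_Ioo⟩
  refine (h1.sub h2).congr ?_
  intro x _
  by_cases hx : x ∈ Set.Ioo (-a) a <;> simp [weight, hx]

theorem pairing_comm (α a : ℝ) (p q : ℝ[X]) : pairing α a p q = pairing α a q p := by
  simp only [pairing, mul_comm (p.eval _)]

theorem pairing_sub_left {α : ℝ} (hα : 0 < α) (a : ℝ) (p q r : ℝ[X]) :
    pairing α a (p - q) r = pairing α a p r - pairing α a q r := by
  unfold pairing
  rw [← intervalIntegral.integral_sub (intervalIntegrable_mul_weight hα a p r _ _)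
    (intervalIntegrable_mul_weight hα a q r _ _)]
  congr 1
  ext x
  simp only [Polynomial.eval_sub]
  ring

theorem pairing_C_mul_left (α a t : ℝ) (p r : ℝ[X]) :
    pairing α a (Polynomial.C t * p) r = t * pairing α a p r := by
  unfold pairing
  rw [← intervalIntegral.integral_const_mul]
  congr 1
  ext x
  simp only [Polynomial.eval_mul, Polynomial.eval_C]
  ring

theorem pairing_sum_left {α : ℝ} (hα : 0 < α) (a : ℝ) {ι : Type*} (s : Finset ι) (f : ι → ℝ[X])
    (r : ℝ[X]) : pairing α a (∑ i ∈ s, f i) r = ∑ i ∈ s, pairing α a (f i) r := by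
  unfold pairing
  rw [← intervalIntegral.integral_finsetSum
    fun i _ => intervalIntegrable_mul_weight hα a (f i) r _ _]
  congr 1
  ext x
  simp only [Polynomial.eval_finsetSum, Finset.sum_mul]

theorem pairing_self_pos {α : ℝ} (hα : 0 < α) {a : ℝ} (ha : a ∈ Set.Ioo (0 : ℝ) 1) {p : ℝ[X]}
    (hp : p ≠ 0) : 0 < pairing α a p p := by
  have hw : ∀ x ∈ Set.Icc (-1 : ℝ) 1, 0 ≤ p.eval x * p.eval x * weight α a x := by
    intro x hx
    have h1 : (0 : ℝ) ≤ 1 - x ^ 2 := by nlinarith [hx.1, hx.2]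
    refine mul_nonneg (mul_self_nonneg _) (mul_nonneg (Real.rpow_nonneg h1 _) ?_)
    by_cases hx' : x ∈ Set.Ioo (-a) a <;> simp [hx']
  have hle : (∫ x in a..1, p.eval x * p.eval x * weight α a x) ≤ pairing α a p p := by
    refine intervalIntegral.integral_mono_interval (by linarith [ha.1]) ha.2.le le_rfl ?_
      (intervalIntegrable_mul_weight hα a p p _ _)
    filter_upwards [MeasureTheory.ae_restrict_mem measurableSet_Ioc] with x hx
    exact hw x ⟨hx.1.le, hx.2⟩
  refine lt_of_lt_of_le ?_ hle
  have heq : (∫ x in a..1, p.eval x * p.eval x * weight α a x) =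
      ∫ x in a..1, p.eval x * p.eval x * (1 - x ^ 2) ^ α := by
    refine intervalIntegral.integral_congr fun x hx => ?_
    rw [Set.uIcc_of_le ha.2.le] at hx
    have : x ∉ Set.Ioo (-a) a := fun hx' => absurd hx'.2 (not_lt.2 hx.1)
    simp [weight, this]
  rw [heq]
  refine intervalIntegral.integral_pos ha.2 (Continuous.continuousOn ?_) ?_ ?_
  · exact (p.continuous.mul p.continuous).mul
      ((continuous_const.sub (continuous_pow 2)).rpow_const fun _ => Or.inr hα.le)
  · intro x hx
    have h1 : (0 : ℝ) ≤ 1 - x ^ 2 := by nlinarith [hx.1, hx.2, ha.1]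
    exact mul_nonneg (mul_self_nonneg _) (Real.rpow_nonneg h1 _)
  · obtain ⟨c, hc, hc'⟩ := (Set.Ioo_infinite ha.2).exists_notMem_finset p.roots.toFinset
    have hne : p.eval c ≠ 0 := by
      intro h0
      exact hc' (by simp [hp, h0])
    have h1 : (0 : ℝ) < 1 - c ^ 2 := by nlinarith [hc.1, hc.2, ha.1]
    exact ⟨c, ⟨hc.1.le, hc.2.le⟩, mul_pos (mul_self_pos.2 hne) (Real.rpow_pos_of_pos h1 _)⟩

theorem h_pos {α : ℝ} (hα : 0 < α) (n : ℕ) {a : ℝ} (ha : a ∈ Set.Ioo (0 : ℝ) 1) : 0 < h α n a :=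
  pairing_self_pos hα ha (P_monic α a n).ne_zero

theorem pairing_P_of_lt {α : ℝ} (hα : 0 < α) {a : ℝ} (ha : a ∈ Set.Ioo (0 : ℝ) 1) (n : ℕ) :
    ∀ j < n, pairing α a (P α a n) (P α a j) = 0 := by
  induction n using Nat.strong_induction_on with
  | _ n ih =>
    intro j hj
    rw [P_eq α a n, pairing_sub_left hα, pairing_sum_left hα,
      Finset.sum_eq_single (⟨j, hj⟩ : Fin n)]
    · have hj0 : pairing α a (P α a j) (P α a j) ≠ 0 := (h_pos hα j ha).ne'
      rw [pairing_C_mul_left, div_mul_cancel₀ _ hj0, sub_self]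
    · intro k _ hk
      rw [pairing_C_mul_left]
      rcases lt_or_gt_of_ne (fun h0 : (k : ℕ) = j => hk (Fin.ext h0)) with hlt | hlt
      · rw [pairing_comm α a (P α a k) (P α a j), ih j hj k hlt, mul_zero]
      · rw [ih k k.2 j hlt, mul_zero]
    · simp

theorem pairing_P_of_ne {α : ℝ} (hα : 0 < α) {a : ℝ} (ha : a ∈ Set.Ioo (0 : ℝ) 1) {j k : ℕ}
    (hjk : j ≠ k) : pairing α a (P α a j) (P α a k) = 0 := by
  rcases lt_or_gt_of_ne hjk with hlt | hlt
  · rw [pairing_comm, pairing_P_of_lt hα ha k j hlt]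
  · exact pairing_P_of_lt hα ha j k hlt

/-- `P_0, …, P_{n-1}` being orthogonal to `q` forces `q` to be orthogonal to all polynomials of
degree less than `n`. -/
theorem pairing_eq_zero_of_degree_lt {α : ℝ} (hα : 0 < α) (a : ℝ) (q : ℝ[X]) (n : ℕ)
    (hq : ∀ j < n, pairing α a (P α a j) q = 0) (p : ℝ[X]) (hp : p.degree < n) :
    pairing α a p q = 0 := by
  induction n generalizing p with
  | zero =>
    have : p = 0 := by simpa using hp
    simp [this, pairing]
  | succ n ih =>
    have hd : (p - Polynomial.C (p.coeff n) * P α a n).degree < (n : WithBot ℕ) := by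
      rw [Polynomial.degree_lt_iff_coeff_zero]
      intro m hm
      rcases hm.eq_or_lt with rfl | hm
      · have h1 := (P_monic α a n).coeff_natDegree
        rw [natDegree_P] at h1
        simp [h1]
      · have h1 : p.coeff m = 0 := (Polynomial.degree_lt_iff_coeff_zero _ _).1 hp m hm
        have h2 : (P α a n).coeff m = 0 :=
          Polynomial.coeff_eq_zero_of_natDegree_lt (by rwa [natDegree_P])
        simp [h1, h2]
    have h0 := ih (fun j hj => hq j (hj.trans n.lt_succ_self)) _ hd
    rw [pairing_sub_left hα, pairing_C_mul_left, hq n n.lt_succ_self, mul_zero, sub_zero] at h0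
    exact h0

/-- `P_n` is the only monic polynomial of degree `n` orthogonal to all polynomials of smaller
degree. -/
theorem P_unique {α : ℝ} (hα : 0 < α) {a : ℝ} (ha : a ∈ Set.Ioo (0 : ℝ) 1) (n : ℕ) (q : ℝ[X])
    (hq : q.Monic) (hn : q.natDegree = n)
    (ho : ∀ p : ℝ[X], p.degree < n → pairing α a p q = 0) : q = P α a n := by
  by_contra hne
  have hd : (q - P α a n).degree < (n : WithBot ℕ) := by
    have h1 : q.degree = (n : WithBot ℕ) := by
      rw [Polynomial.degree_eq_natDegree hq.ne_zero, hn]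
    have h2 : (P α a n).degree = (n : WithBot ℕ) := by
      rw [Polynomial.degree_eq_natDegree (P_monic α a n).ne_zero, natDegree_P]
    rw [← h1]
    exact Polynomial.degree_sub_lt_left (h1.trans h2.symm) hq.ne_zero
      (by rw [hq.leadingCoeff, (P_monic α a n).leadingCoeff])
  have h1 := ho _ hd
  have h2 := pairing_eq_zero_of_degree_lt hα a (P α a n) n
    (fun j hj => pairing_P_of_ne hα ha hj.ne) _ hd
  have h3 := pairing_self_pos hα ha (sub_ne_zero.2 hne)
  rw [pairing_sub_left hα, pairing_comm α a q, pairing_comm α a (P α a n), h1, h2, sub_zero] at h3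
  exact lt_irrefl _ h3

end JacobiGap

end

open scoped Polynomial

noncomputable section

namespace JacobiGap

/-! Put M = 2n + 1 + 2α, β = h_{n+1}/h_n and S = 2 P_n(a,a) P_{n+1}(a,a) (1-a²)^α / h_n. The pair
(R, S) satisfies a first-order system in which β is a further unknown, and one algebraic relation
governs β. Eliminating β and S leaves a second-order equation for R alone.

The system rests on boundary terms at ±a. Integration by parts expresses (1-x²) ∂ₓP_n through P_n,
P_{n+1} and Christoffel-Darboux kernels at ±a (`structure_kernel`). Differentiating the
orthogonality relations in a expresses ∂ₐP_n through kernels at the same points (`eval_derivP`). In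
the total derivative of P_n(a,a) the diagonal kernels cancel up to a single term, and what remains
is rational in a, (1-a²)^α, h_n, P_n(a,a) and P_{n+1}(a,a) (`hasDerivAt_eval_P_self`). Together with
h_n' and the recurrence this gives `hasDerivAt_R` and `hasDerivAt_S`.

The algebraic relation comes from x = 1, where the term (1-x²) ∂ₓP drops out. The structure
relations of index n and n+1 become two homogeneous linear equations for P_n(1), P_{n+1}(1); since
P_n(1) ≠ 0, their determinant vanishes (`recurrence_coeff_relation`). -/

/-! ### Calculus of the pairing: moving endpoints and integration by parts. -/

theorem pairing_mul_left (α a : ℝ) (p q r : ℝ[X]) :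
    pairing α a (r * p) q = pairing α a p (r * q) := by
  unfold pairing
  congr 1
  ext x
  simp only [Polynomial.eval_mul]
  ring

theorem pairing_add_left {α : ℝ} (hα : 0 < α) (a : ℝ) (p q r : ℝ[X]) :
    pairing α a (p + q) r = pairing α a p r + pairing α a q r := by
  have h1 := pairing_sub_left hα a (p + q) q r
  rw [add_sub_cancel_right] at h1
  linarith

theorem continuous_mul_rpow {β : ℝ} (hβ : 0 < β) (f : ℝ[X]) :
    Continuous fun x : ℝ => f.eval x * (1 - x ^ 2) ^ β :=
  f.continuous.mul ((continuous_const.sub (continuous_pow 2)).rpow_const fun _ => Or.inr hβ.le)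

/-- The pairing as a sum of integrals over the two intervals that support the weight. -/
theorem pairing_eq_add {α : ℝ} (hα : 0 < α) {a : ℝ} (ha : a ∈ Set.Ioo (0 : ℝ) 1) (p q : ℝ[X]) :
    pairing α a p q = (∫ x in (-1 : ℝ)..(-a), (p * q).eval x * (1 - x ^ 2) ^ α) +
      ∫ x in a..1, (p * q).eval x * (1 - x ^ 2) ^ α := by
  have hi := intervalIntegrable_mul_weight hα a p q
  unfold pairing
  rw [← intervalIntegral.integral_add_adjacent_intervals (hi (-1) (-a)) (hi (-a) 1),
    ← intervalIntegral.integral_add_adjacent_intervals (hi (-a) a) (hi a 1)]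
  have hmid : (∫ x in (-a)..a, p.eval x * q.eval x * weight α a x) = 0 := by
    rw [intervalIntegral.integral_of_le (by linarith [ha.1]),
      MeasureTheory.integral_Ioc_eq_integral_Ioo]
    rw [MeasureTheory.setIntegral_congr_fun (g := fun _ => (0 : ℝ)) measurableSet_Ioo]
    · simp
    · intro x hx
      simp only [weight, Set.indicator_of_mem hx, sub_self, mul_zero]
  rw [hmid, zero_add]
  congr 1
  · refine intervalIntegral.integral_congr fun x hx => ?_
    rw [Set.uIcc_of_le (by linarith [ha.2])] at hx
    have : x ∉ Set.Ioo (-a) a := fun hx' => absurd hx'.1 (not_lt.2 hx.2)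
    simp [weight, this]
  · refine intervalIntegral.integral_congr fun x hx => ?_
    rw [Set.uIcc_of_le ha.2.le] at hx
    have : x ∉ Set.Ioo (-a) a := fun hx' => absurd hx'.2 (not_lt.2 hx.1)
    simp [weight, this]

/-- By the fundamental theorem of calculus: as a grows, the support loses mass at both inner
endpoints ±a. -/
theorem hasDerivAt_pairing {α : ℝ} (hα : 0 < α) {a : ℝ} (ha : a ∈ Set.Ioo (0 : ℝ) 1)
    (p q : ℝ[X]) :
    HasDerivAt (fun b => pairing α b p q)
      (-((p * q).eval a + (p * q).eval (-a)) * (1 - a ^ 2) ^ α) a := by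
  have hc := continuous_mul_rpow hα (p * q)
  have h1 : HasDerivAt (fun b => ∫ x in b..1, (p * q).eval x * (1 - x ^ 2) ^ α)
      (-((p * q).eval a * (1 - a ^ 2) ^ α)) a :=
    intervalIntegral.integral_hasDerivAt_left (hc.intervalIntegrable _ _)
      hc.stronglyMeasurable.stronglyMeasurableAtFilter hc.continuousAt
  have h2 : HasDerivAt (fun b => ∫ x in (-1 : ℝ)..b, (p * q).eval x * (1 - x ^ 2) ^ α)
      ((p * q).eval (-a) * (1 - (-a) ^ 2) ^ α) (-a) :=
    intervalIntegral.integral_hasDerivAt_right (hc.intervalIntegrable _ _)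
      hc.stronglyMeasurable.stronglyMeasurableAtFilter hc.continuousAt
  have h3 := (HasDerivAt.comp a h2 (hasDerivAt_neg a)).add h1
  refine (h3.congr_deriv ?_).congr_of_eventuallyEq ?_
  · rw [neg_sq]; ring
  · filter_upwards [Ioo_mem_nhds ha.1 ha.2] with b hb
    exact pairing_eq_add hα hb p q

/-- Integration by parts against the Jacobi weight on the two intervals. -/
theorem pairing_derivative {α : ℝ} (hα : 0 < α) {a : ℝ} (ha : a ∈ Set.Ioo (0 : ℝ) 1)
    (f : ℝ[X]) :
    pairing α a ((1 - Polynomial.X ^ 2) * Polynomial.derivative f) 1 =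
      2 * (α + 1) * pairing α a (Polynomial.X * f) 1
        - (f.eval a - f.eval (-a)) * ((1 - a ^ 2) * (1 - a ^ 2) ^ α) := by
  set g : ℝ[X] := (1 - Polynomial.X ^ 2) * Polynomial.derivative f
    - Polynomial.C (2 * (α + 1)) * (Polynomial.X * f) with hg
  have hd : ∀ x ∈ Set.Icc (-1 : ℝ) 1, HasDerivAt (fun x : ℝ => f.eval x * (1 - x ^ 2) ^ (α + 1))
      ((g * 1).eval x * (1 - x ^ 2) ^ α) x := by
    intro x hx
    have h0 : (0 : ℝ) ≤ 1 - x ^ 2 := by nlinarith [hx.1, hx.2]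
    have h1 : HasDerivAt (fun x : ℝ => 1 - x ^ 2) (-(2 * x)) x := by
      simpa using ((hasDerivAt_pow 2 x).const_sub 1)
    -- The exponent α + 1 ≥ 1 makes the power differentiable even at x = ±1, where its base is 0.
    refine ((f.hasDerivAt x).mul (h1.rpow_const (p := α + 1) (Or.inr (by linarith)))).congr_deriv ?_
    rw [add_sub_cancel_right, Real.rpow_add_one' h0 (by linarith), hg]
    simp only [Polynomial.eval_mul, Polynomial.eval_sub, Polynomial.eval_one, Polynomial.eval_pow,
      Polynomial.eval_X, Polynomial.eval_C]
    ring
  have hii : ∀ b c : ℝ, IntervalIntegrable (fun x => (g * 1).eval x * (1 - x ^ 2) ^ α)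
      MeasureTheory.volume b c := fun b c => (continuous_mul_rpow hα (g * 1)).intervalIntegrable _ _
  have key : pairing α a g 1 = -(f.eval a - f.eval (-a)) * ((1 - a ^ 2) * (1 - a ^ 2) ^ α) := by
    rw [pairing_eq_add hα ha,
      intervalIntegral.integral_eq_sub_of_hasDerivAt (fun x hx => hd x ?_) (hii _ _),
      intervalIntegral.integral_eq_sub_of_hasDerivAt (fun x hx => hd x ?_) (hii _ _)]
    · have h0 : (0 : ℝ) ≤ 1 - a ^ 2 := by nlinarith [ha.1, ha.2]
      have h1 : α + 1 ≠ 0 := by linarith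
      rw [neg_sq, Real.rpow_add_one' h0 h1]
      norm_num [Real.zero_rpow h1]
      ring
    · rw [Set.uIcc_of_le (by linarith [ha.2])] at hx
      exact ⟨by linarith [hx.1, ha.1], hx.2⟩
    · rw [Set.uIcc_of_le (by linarith [ha.2])] at hx
      exact ⟨hx.1, by linarith [hx.2, ha.1]⟩
  rw [hg, pairing_sub_left hα, pairing_C_mul_left] at key
  linarith

/-! ### Parity. -/

theorem pairing_comp_neg (α a : ℝ) (p q : ℝ[X]) :
    pairing α a (p.comp (-Polynomial.X)) (q.comp (-Polynomial.X)) = pairing α a p q := by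
  unfold pairing
  have hw : ∀ x, weight α a (-x) = weight α a x := by
    intro x
    have : (-x ∈ Set.Ioo (-a) a) ↔ x ∈ Set.Ioo (-a) a := by
      simp only [Set.mem_Ioo]
      constructor <;> rintro ⟨h1, h2⟩ <;> constructor <;> linarith
    by_cases hx : x ∈ Set.Ioo (-a) a
    · simp [weight, Set.indicator_of_mem hx, Set.indicator_of_mem (this.2 hx)]
    · simp [weight, Set.indicator_of_notMem hx, Set.indicator_of_notMem (mt this.1 hx)]
  have h1 := intervalIntegral.integral_comp_neg (a := -1) (b := 1)
    (fun x => p.eval x * q.eval x * weight α a x)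
  rw [neg_neg] at h1
  rw [← h1]
  simp [hw]

/-- The weight is even, so (-1)^n P_n(-x) is again monic of degree n and orthogonal to lower
degrees; uniqueness identifies it with P_n. -/
theorem P_comp_neg {α : ℝ} (hα : 0 < α) {a : ℝ} (ha : a ∈ Set.Ioo (0 : ℝ) 1) (n : ℕ) :
    (P α a n).comp (-Polynomial.X) = Polynomial.C ((-1) ^ n) * P α a n := by
  have hsq : ((-1 : ℝ) ^ n) * (-1) ^ n = 1 := by rw [← mul_pow]; norm_num
  have hdX : (-Polynomial.X : ℝ[X]).natDegree = 1 := by simp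
  have hnd : ((P α a n).comp (-Polynomial.X)).natDegree = n := by
    rw [Polynomial.natDegree_comp, hdX, natDegree_P, mul_one]
  have hlc : ((P α a n).comp (-Polynomial.X)).leadingCoeff = (-1) ^ n := by
    rw [Polynomial.leadingCoeff_comp (by rw [hdX]; norm_num), (P_monic α a n).leadingCoeff,
      natDegree_P]
    simp
  have hne : ((-1 : ℝ) ^ n) ≠ 0 := pow_ne_zero _ (by norm_num)
  have h1 : Polynomial.C ((-1 : ℝ) ^ n) * (P α a n).comp (-Polynomial.X) = P α a n := by
    refine P_unique hα ha n _ ?_ ?_ fun p hp => ?_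
    · rw [Polynomial.Monic, Polynomial.leadingCoeff_mul, Polynomial.leadingCoeff_C, hlc, hsq]
    · rw [Polynomial.natDegree_C_mul hne, hnd]
    · rw [pairing_comm, pairing_C_mul_left, ← pairing_comp_neg, Polynomial.comp_assoc]
      rw [pairing_comm, show (-Polynomial.X : ℝ[X]).comp (-Polynomial.X) = Polynomial.X by simp,
        Polynomial.comp_X]
      rw [pairing_eq_zero_of_degree_lt hα a (P α a n) n
        (fun j hj => pairing_P_of_ne hα ha hj.ne), mul_zero]
      by_cases hp0 : p = 0
      · simp [hp0]
      · rw [← Polynomial.natDegree_lt_iff_degree_lt] at hp ⊢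
        · rwa [Polynomial.natDegree_comp, hdX, mul_one]
        · intro h0
          have h2 := congrArg (fun r : ℝ[X] => r.comp (-Polynomial.X)) h0
          simp only [Polynomial.comp_assoc, Polynomial.zero_comp] at h2
          rw [show (-Polynomial.X : ℝ[X]).comp (-Polynomial.X) = Polynomial.X by simp,
            Polynomial.comp_X] at h2
          exact hp0 h2
        · exact hp0
  conv_rhs => rw [← h1, ← mul_assoc, ← Polynomial.C_mul, hsq, Polynomial.C_1, one_mul]

theorem eval_neg_P {α : ℝ} (hα : 0 < α) {a : ℝ} (ha : a ∈ Set.Ioo (0 : ℝ) 1) (n : ℕ) (x : ℝ) :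
    (P α a n).eval (-x) = (-1) ^ n * (P α a n).eval x := by
  have h1 := congrArg (fun r : ℝ[X] => r.eval x) (P_comp_neg hα ha n)
  simpa [Polynomial.eval_comp] using h1

theorem pairing_X_mul_P_self {α : ℝ} (hα : 0 < α) {a : ℝ} (ha : a ∈ Set.Ioo (0 : ℝ) 1) (n : ℕ) :
    pairing α a (Polynomial.X * P α a n) (P α a n) = 0 := by
  have hsq : ((-1 : ℝ) ^ n) * (-1) ^ n = 1 := by rw [← mul_pow]; norm_num
  have h1 := pairing_comp_neg α a (Polynomial.X * P α a n) (P α a n)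
  have h2 : (Polynomial.X * P α a n).comp (-Polynomial.X) =
      Polynomial.C (-(-1) ^ n) * (Polynomial.X * P α a n) := by
    rw [Polynomial.mul_comp, Polynomial.X_comp, P_comp_neg hα ha, Polynomial.C_neg]
    ring
  rw [h2, P_comp_neg hα ha, pairing_C_mul_left, pairing_comm, pairing_C_mul_left,
    pairing_comm] at h1
  linear_combination (-1 / 2 : ℝ) * h1 - (1 / 2) * hsq *
    pairing α a (Polynomial.X * P α a n) (P α a n)

/-! ### Orthogonal expansion, three-term recurrence and Christoffel-Darboux formula. -/

/-- Expansion of a polynomial of degree less than `m` in the orthogonal basis. -/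
theorem eq_sum_of_degree_lt {α : ℝ} (hα : 0 < α) {a : ℝ} (ha : a ∈ Set.Ioo (0 : ℝ) 1) (m : ℕ)
    (f : ℝ[X]) (hf : f.degree < m) :
    f = ∑ k ∈ Finset.range m, Polynomial.C (pairing α a f (P α a k) / h α k a) * P α a k := by
  by_contra hne
  set g := f - ∑ k ∈ Finset.range m, Polynomial.C (pairing α a f (P α a k) / h α k a) * P α a k
    with hg
  have hgd : g.degree < m := by
    refine lt_of_le_of_lt (Polynomial.degree_sub_le _ _) (max_lt hf ?_)
    refine lt_of_le_of_lt (Polynomial.degree_sum_le _ _) ?_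
    refine (Finset.sup_lt_iff (WithBot.bot_lt_coe m)).2 fun k hk => ?_
    rw [← Polynomial.smul_eq_C_mul]
    refine lt_of_le_of_lt (Polynomial.degree_smul_le _ _) ?_
    rw [Polynomial.degree_eq_natDegree (P_monic α a k).ne_zero, natDegree_P]
    exact WithBot.coe_lt_coe.2 (Nat.cast_lt.2 (Finset.mem_range.1 hk))
  have hgo : ∀ j < m, pairing α a (P α a j) g = 0 := by
    intro j hj
    rw [pairing_comm, hg, pairing_sub_left hα, pairing_sum_left hα, Finset.sum_eq_single j]
    · rw [pairing_C_mul_left]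
      change _ - _ / h α j a * h α j a = 0
      rw [div_mul_cancel₀ _ (h_pos hα j ha).ne', sub_self]
    · intro k _ hk
      rw [pairing_C_mul_left, pairing_P_of_ne hα ha hk, mul_zero]
    · intro hj'
      exact absurd (Finset.mem_range.2 hj) hj'
  exact (pairing_self_pos hα ha (sub_ne_zero.2 hne)).ne'
    (pairing_eq_zero_of_degree_lt hα a g m hgo g hgd)

theorem coeff_P_self (α a : ℝ) (n : ℕ) : (P α a n).coeff n = 1 := by
  have h1 := (P_monic α a n).coeff_natDegree
  rwa [natDegree_P] at h1

theorem coeff_P_of_lt (α a : ℝ) {n m : ℕ} (h : n < m) : (P α a n).coeff m = 0 :=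
  Polynomial.coeff_eq_zero_of_natDegree_lt (by rwa [natDegree_P])

theorem pairing_P_eq_zero_of_degree_lt {α : ℝ} (hα : 0 < α) {a : ℝ} (ha : a ∈ Set.Ioo (0 : ℝ) 1)
    (n : ℕ) (p : ℝ[X]) (hp : p.degree < n) : pairing α a p (P α a n) = 0 :=
  pairing_eq_zero_of_degree_lt hα a (P α a n) n (fun _ hj => pairing_P_of_ne hα ha hj.ne) p hp

theorem degree_X_mul_P_sub (α a : ℝ) (n : ℕ) :
    (Polynomial.X * P α a n - P α a (n + 1)).degree < ((n + 1 : ℕ) : WithBot ℕ) := by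
  rw [Polynomial.degree_lt_iff_coeff_zero]
  intro m hm
  obtain ⟨m, rfl⟩ : ∃ k, m = k + 1 := ⟨m - 1, by omega⟩
  rw [Polynomial.coeff_sub, Polynomial.coeff_X_mul]
  rcases (Nat.succ_le_succ_iff.1 hm).eq_or_lt with rfl | hlt
  · rw [coeff_P_self, coeff_P_self, sub_self]
  · rw [coeff_P_of_lt α a hlt, coeff_P_of_lt α a (Nat.succ_lt_succ hlt), sub_self]

theorem degree_one_sub_X_sq_mul_derivative_P_add (α a : ℝ) (n : ℕ) :
    ((1 - Polynomial.X ^ 2) * Polynomial.derivative (P α a n) +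
      Polynomial.C (n : ℝ) * P α a (n + 1)).degree < ((n + 1 : ℕ) : WithBot ℕ) := by
  rw [Polynomial.degree_lt_iff_coeff_zero]
  intro m hm
  obtain ⟨m, rfl⟩ : ∃ k, m = k + 1 := ⟨m - 1, by omega⟩
  rw [Polynomial.coeff_add, Polynomial.coeff_C_mul, sub_mul, one_mul, Polynomial.coeff_sub,
    Polynomial.coeff_derivative, pow_two, mul_assoc, Polynomial.coeff_X_mul]
  have h1 : (Polynomial.X * Polynomial.derivative (P α a n)).coeff m = (P α a n).coeff m * m := by
    cases m with
    | zero => simp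
    | succ m =>
      rw [Polynomial.coeff_X_mul, Polynomial.coeff_derivative]
      push_cast
      ring
  rw [h1, coeff_P_of_lt α a (show n < m + 1 + 1 by omega)]
  rcases (Nat.succ_le_succ_iff.1 hm).eq_or_lt with rfl | hlt
  · rw [coeff_P_self, coeff_P_self]; ring
  · rw [coeff_P_of_lt α a hlt, coeff_P_of_lt α a (Nat.succ_lt_succ hlt)]; ring

theorem pairing_X_mul_P_of_lt {α : ℝ} (hα : 0 < α) {a : ℝ} (ha : a ∈ Set.Ioo (0 : ℝ) 1) {n k : ℕ}
    (hk : k < n) :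
    pairing α a (Polynomial.X * P α a n) (P α a k) = pairing α a (P α a n) (P α a (k + 1)) := by
  have h1 := pairing_P_eq_zero_of_degree_lt hα ha n _
    (lt_of_lt_of_le (degree_X_mul_P_sub α a k) (by exact_mod_cast hk))
  rw [pairing_sub_left hα, sub_eq_zero] at h1
  rw [pairing_mul_left, pairing_comm, h1, pairing_comm]

theorem P_one {α : ℝ} (hα : 0 < α) {a : ℝ} (ha : a ∈ Set.Ioo (0 : ℝ) 1) :
    P α a 1 = Polynomial.X * P α a 0 := by
  have h1 := eq_sum_of_degree_lt hα ha 1 _ (degree_X_mul_P_sub α a 0)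
  rw [Finset.sum_range_one, pairing_sub_left hα, pairing_X_mul_P_self hα ha,
    pairing_P_of_ne hα ha (by norm_num)] at h1
  rw [sub_zero, zero_div, Polynomial.C_0, zero_mul, sub_eq_zero] at h1
  exact h1.symm

theorem P_zero (α a : ℝ) : P α a 0 = 1 := by
  rw [P_eq]; simp

/-- The three-term recurrence. -/
theorem P_add_two {α : ℝ} (hα : 0 < α) {a : ℝ} (ha : a ∈ Set.Ioo (0 : ℝ) 1) (n : ℕ) :
    P α a (n + 2) = Polynomial.X * P α a (n + 1) -
      Polynomial.C (h α (n + 1) a / h α n a) * P α a n := by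
  have h1 := eq_sum_of_degree_lt hα ha (n + 2) _ (degree_X_mul_P_sub α a (n + 1))
  rw [Finset.sum_eq_single n] at h1
  · rw [pairing_sub_left hα, pairing_X_mul_P_of_lt hα ha n.lt_succ_self,
      pairing_P_of_ne hα ha (show n + 1 + 1 ≠ n by omega), sub_zero] at h1
    change _ - _ = Polynomial.C (h α (n + 1) a / h α n a) * P α a n at h1
    rw [← h1]
    ring
  · intro k hk hkn
    rw [pairing_sub_left hα, pairing_P_of_ne hα ha (Finset.mem_range.1 hk).ne', sub_zero]
    rcases (Nat.lt_succ_iff.1 (Finset.mem_range.1 hk)).eq_or_lt with rfl | hlt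
    · rw [pairing_X_mul_P_self hα ha, zero_div, Polynomial.C_0, zero_mul]
    · rw [pairing_X_mul_P_of_lt hα ha hlt, pairing_P_of_ne hα ha (by omega), zero_div,
        Polynomial.C_0, zero_mul]
  · intro hn
    exact absurd (Finset.mem_range.2 (by omega)) hn

/-- The Christoffel-Darboux kernel. -/
def kernel (α a : ℝ) (m : ℕ) (x y : ℝ) : ℝ :=
  ∑ k ∈ Finset.range m, (P α a k).eval x * (P α a k).eval y / h α k a

theorem kernel_succ (α a : ℝ) (m : ℕ) (x y : ℝ) : kernel α a (m + 1) x y =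
    kernel α a m x y + (P α a m).eval x * (P α a m).eval y / h α m a :=
  Finset.sum_range_succ _ _

theorem christoffel_darboux {α : ℝ} (hα : 0 < α) {a : ℝ} (ha : a ∈ Set.Ioo (0 : ℝ) 1) (n : ℕ)
    (x y : ℝ) : kernel α a (n + 1) x y * (x - y) * h α n a =
      (P α a (n + 1)).eval x * (P α a n).eval y - (P α a n).eval x * (P α a (n + 1)).eval y := by
  induction n with
  | zero =>
    have h0 := (h_pos hα 0 ha).ne'
    rw [kernel, Finset.sum_range_one, P_one hα ha, P_zero]
    simp only [Polynomial.eval_mul, Polynomial.eval_X, Polynomial.eval_one]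
    field_simp
  | succ n ih =>
    have h0 := (h_pos hα n ha).ne'
    have h1 := (h_pos hα (n + 1) ha).ne'
    rw [kernel_succ, P_add_two hα ha]
    simp only [Polynomial.eval_mul, Polynomial.eval_X, Polynomial.eval_sub, Polynomial.eval_C]
    field_simp
    linear_combination h α (n + 1) a * ih

/-- The kernel reproduces point evaluation. Two points y, z are allowed because boundary terms
always occur at both a and -a. -/
theorem eval_eq_kernel_of_pairing {α : ℝ} (hα : 0 < α) {a : ℝ} (ha : a ∈ Set.Ioo (0 : ℝ) 1) (m : ℕ)
    (f : ℝ[X]) (hf : f.degree < m) (c : ℝ) (y z d : ℝ)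
    (hc : ∀ k < m, pairing α a f (P α a k) = c * (P α a k).eval y + d * (P α a k).eval z) (x : ℝ) :
    f.eval x = c * kernel α a m x y + d * kernel α a m x z := by
  conv_lhs => rw [eq_sum_of_degree_lt hα ha m f hf]
  rw [Polynomial.eval_finsetSum, kernel, kernel, Finset.mul_sum, Finset.mul_sum,
    ← Finset.sum_add_distrib]
  refine Finset.sum_congr rfl fun k hk => ?_
  rw [hc k (Finset.mem_range.1 hk)]
  simp only [Polynomial.eval_mul, Polynomial.eval_C]
  ring

/-! ### The structure relation for the x-derivative. -/

theorem pairing_derivative_left {α : ℝ} (hα : 0 < α) {a : ℝ} (ha : a ∈ Set.Ioo (0 : ℝ) 1)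
    (p q : ℝ[X]) :
    pairing α a ((1 - Polynomial.X ^ 2) * Polynomial.derivative p) q =
      2 * (α + 1) * pairing α a (Polynomial.X * p) q
        - pairing α a ((1 - Polynomial.X ^ 2) * Polynomial.derivative q) p
        - ((p * q).eval a - (p * q).eval (-a)) * ((1 - a ^ 2) * (1 - a ^ 2) ^ α) := by
  have h1 := pairing_derivative hα ha (p * q)
  have h2 : ∀ f g : ℝ[X], pairing α a (f * g) 1 = pairing α a f g := by
    intro f g
    rw [mul_comm, pairing_mul_left, mul_one]
  rw [Polynomial.derivative_mul, mul_add, pairing_add_left hα, ← mul_assoc, h2,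
    show (1 - Polynomial.X ^ 2) * (p * Polynomial.derivative q) =
      ((1 - Polynomial.X ^ 2) * Polynomial.derivative q) * p by ring, h2, ← mul_assoc, h2] at h1
  linarith

/-- The structure relation, with the boundary contributions at `±a` given by the kernel. -/
theorem structure_kernel {α : ℝ} (hα : 0 < α) {a : ℝ} (ha : a ∈ Set.Ioo (0 : ℝ) 1) (n : ℕ)
    (x : ℝ) :
    (1 - x ^ 2) * (Polynomial.derivative (P α a n)).eval x + n * (P α a (n + 1)).eval x
      - (n + 1 + 2 * α) * (x * (P α a n).eval x - (P α a (n + 1)).eval x) =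
    -((1 - a ^ 2) * (1 - a ^ 2) ^ α * (P α a n).eval a) *
      (kernel α a (n + 1) x a - (-1) ^ n * kernel α a (n + 1) x (-a)) := by
  -- The term n P_{n+1} lowers the degree to at most n. Apart from boundary terms, the pairing with
  -- P_k is then nonzero only for k = n - 1, where it is (2(α+1) + n - 1) h_n; this fixes the
  -- constant n + 1 + 2α.
  have hd : ((1 - Polynomial.X ^ 2) * Polynomial.derivative (P α a n) +
      Polynomial.C (n : ℝ) * P α a (n + 1) - Polynomial.C (n + 1 + 2 * α) *
        (Polynomial.X * P α a n - P α a (n + 1))).degree < ((n + 1 : ℕ) : WithBot ℕ) := by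
    refine lt_of_le_of_lt (Polynomial.degree_sub_le _ _)
      (max_lt (degree_one_sub_X_sq_mul_derivative_P_add α a n) ?_)
    rw [← Polynomial.smul_eq_C_mul]
    exact lt_of_le_of_lt (Polynomial.degree_smul_le _ _) (degree_X_mul_P_sub α a n)
  have h1 := eval_eq_kernel_of_pairing hα ha (n + 1) _ hd
    (-((1 - a ^ 2) * (1 - a ^ 2) ^ α * (P α a n).eval a)) a (-a)
    ((1 - a ^ 2) * (1 - a ^ 2) ^ α * (-1) ^ n * (P α a n).eval a) ?_ x
  · simp only [Polynomial.eval_mul, Polynomial.eval_X, Polynomial.eval_sub, Polynomial.eval_C,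
      Polynomial.eval_add, Polynomial.eval_one, Polynomial.eval_pow] at h1
    rw [h1]
    ring
  · intro k hk
    rw [pairing_sub_left hα, pairing_add_left hα, pairing_C_mul_left, pairing_C_mul_left,
      pairing_sub_left hα, pairing_P_of_ne hα ha hk.ne']
    have hp := pairing_derivative_left hα ha (P α a n) (P α a k)
    simp only [Polynomial.eval_mul] at hp
    rw [eval_neg_P hα ha n a] at hp
    rcases (Nat.lt_succ_iff.1 hk).eq_or_lt with rfl | hlt
    -- For k = n the same pairing stands on both sides of `hp`, hence the factor 1/2; by parity the
    -- boundary terms cancel.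
    · rw [pairing_X_mul_P_self hα ha] at hp ⊢
      rw [eval_neg_P hα ha k a] at hp ⊢
      have hsq : ((-1 : ℝ) ^ k) * (-1) ^ k = 1 := by rw [← mul_pow]; norm_num
      linear_combination (1 / 2) * hp -
        (1 / 2) * ((1 - a ^ 2) * (1 - a ^ 2) ^ α * (P α a k).eval a ^ 2) * hsq
    · have h2 := pairing_P_eq_zero_of_degree_lt hα ha n _
        (lt_of_lt_of_le (degree_one_sub_X_sq_mul_derivative_P_add α a k) (by exact_mod_cast hlt))
      rw [pairing_add_left hα, pairing_C_mul_left, pairing_comm α a (P α a (k + 1))] at h2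
      rw [pairing_X_mul_P_of_lt hα ha hlt] at hp ⊢
      have h3 : ((k : ℝ) + 1 - n) * pairing α a (P α a n) (P α a (k + 1)) = 0 := by
        rcases eq_or_ne n (k + 1) with rfl | hne
        · push_cast; ring
        · rw [pairing_P_of_ne hα ha hne, mul_zero]
      linear_combination hp - h2 + h3

/-- The structure relation in closed form. -/
theorem structure_relation {α : ℝ} (hα : 0 < α) {a : ℝ} (ha : a ∈ Set.Ioo (0 : ℝ) 1) (n : ℕ)
    (x : ℝ) (hx : x ^ 2 ≠ a ^ 2) :
    (1 - x ^ 2) * (Polynomial.derivative (P α a n)).eval x + n * (P α a (n + 1)).eval x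
      - (n + 1 + 2 * α) * (x * (P α a n).eval x - (P α a (n + 1)).eval x) =
    -(2 * (1 - a ^ 2) * (1 - a ^ 2) ^ α * (P α a n).eval a / h α n a / (x ^ 2 - a ^ 2)) *
      (a * (P α a n).eval a * (P α a (n + 1)).eval x -
        x * (P α a (n + 1)).eval a * (P α a n).eval x) := by
  rw [structure_kernel hα ha]
  have hsq : ((-1 : ℝ) ^ n) * (-1) ^ n = 1 := by rw [← mul_pow]; norm_num
  have h0 := (h_pos hα n ha).ne'
  have h1 := christoffel_darboux hα ha n x a
  have h2 := christoffel_darboux hα ha n x (-a)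
  rw [eval_neg_P hα ha, eval_neg_P hα ha, pow_succ] at h2
  have h3 : x ^ 2 - a ^ 2 ≠ 0 := sub_ne_zero.2 hx
  -- The Christoffel-Darboux formulas at y = a and y = -a are put over the common denominator x² -
  -- a².
  have h4 : kernel α a (n + 1) x a - (-1) ^ n * kernel α a (n + 1) x (-a) =
      2 * (a * (P α a n).eval a * (P α a (n + 1)).eval x -
        x * (P α a (n + 1)).eval a * (P α a n).eval x) / (h α n a * (x ^ 2 - a ^ 2)) := by
    rw [eq_div_iff (mul_ne_zero h0 h3)]
    linear_combination (x + a) * h1 - (-1) ^ n * (x - a) * h2 -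
      (x - a) * ((P α a (n + 1)).eval x * (P α a n).eval a
        + (P α a n).eval x * (P α a (n + 1)).eval a) * hsq
  rw [h4]
  field_simp

/-! ### Dependence on the parameter a. -/

theorem pairing_eq_sum_coeff {α : ℝ} (hα : 0 < α) (a : ℝ) (N : ℕ) (p q : ℝ[X])
    (hp : p.natDegree < N) (hq : q.natDegree < N) :
    pairing α a p q = ∑ i ∈ Finset.range N, ∑ j ∈ Finset.range N,
      p.coeff i * q.coeff j * pairing α a (Polynomial.X ^ i) (Polynomial.X ^ j) := by
  conv_lhs => rw [p.as_sum_range_C_mul_X_pow' hp]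
  rw [pairing_sum_left hα]
  refine Finset.sum_congr rfl fun i _ => ?_
  rw [pairing_C_mul_left, pairing_comm]
  conv_lhs => rw [q.as_sum_range_C_mul_X_pow' hq]
  rw [pairing_sum_left hα, Finset.mul_sum]
  refine Finset.sum_congr rfl fun j _ => ?_
  rw [pairing_C_mul_left, pairing_comm]
  ring

/-- The product rule for the pairing of two polynomials that depend on the parameter. -/
theorem hasDerivAt_pairing_family {α : ℝ} (hα : 0 < α) {a : ℝ} (ha : a ∈ Set.Ioo (0 : ℝ) 1)
    (N : ℕ) (p q : ℝ → ℝ[X]) (p' q' : ℝ[X]) (hpN : ∀ b, (p b).natDegree < N)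
    (hqN : ∀ b, (q b).natDegree < N) (hpN' : p'.natDegree < N) (hqN' : q'.natDegree < N)
    (hp : ∀ i, HasDerivAt (fun b => (p b).coeff i) (p'.coeff i) a)
    (hq : ∀ i, HasDerivAt (fun b => (q b).coeff i) (q'.coeff i) a) :
    HasDerivAt (fun b => pairing α b (p b) (q b))
      (pairing α a p' (q a) + pairing α a (p a) q' -
        ((p a).eval a * (q a).eval a + (p a).eval (-a) * (q a).eval (-a)) * (1 - a ^ 2) ^ α) a := by
  -- With the degree bound N uniform in b, the pairing is a fixed finite sum of coefficients times
  -- moments, and the product rule applies termwise.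
  have h1 : HasDerivAt (fun b => ∑ i ∈ Finset.range N, ∑ j ∈ Finset.range N,
      (p b).coeff i * (q b).coeff j * pairing α b (Polynomial.X ^ i) (Polynomial.X ^ j)) _ a :=
    HasDerivAt.fun_sum fun i _ => HasDerivAt.fun_sum fun j _ =>
      ((hp i).mul (hq j)).mul
        (hasDerivAt_pairing hα ha (Polynomial.X ^ i) (Polynomial.X ^ j))
  simp only [← pairing_eq_sum_coeff hα _ N _ _ (hpN _) (hqN _)] at h1
  refine h1.congr_deriv ?_
  rw [pairing_eq_sum_coeff hα a N _ _ hpN' (hqN a), pairing_eq_sum_coeff hα a N _ _ (hpN a) hqN',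
    Polynomial.eval_eq_sum_range' (hpN a), Polynomial.eval_eq_sum_range' (hqN a),
    Polynomial.eval_eq_sum_range' (hpN a), Polynomial.eval_eq_sum_range' (hqN a),
    Finset.sum_mul_sum, Finset.sum_mul_sum, add_mul, Finset.sum_mul, Finset.sum_mul,
    ← Finset.sum_add_distrib, ← Finset.sum_add_distrib, ← Finset.sum_sub_distrib]
  refine Finset.sum_congr rfl fun i _ => ?_
  rw [Finset.sum_mul, Finset.sum_mul, ← Finset.sum_add_distrib, ← Finset.sum_add_distrib,
    ← Finset.sum_sub_distrib]
  refine Finset.sum_congr rfl fun j _ => ?_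
  simp only [Polynomial.eval_mul, Polynomial.eval_pow, Polynomial.eval_X, Pi.mul_apply]
  ring

/-- The derivative of `P_n(x,a)` with respect to `a`, coefficientwise. -/
def derivP (α : ℝ) (n : ℕ) (a : ℝ) : ℝ[X] :=
  ∑ i ∈ Finset.range n, Polynomial.C (deriv (fun b => (P α b n).coeff i) a) * Polynomial.X ^ i

theorem coeff_derivP (α : ℝ) (n : ℕ) (a : ℝ) (i : ℕ) :
    (derivP α n a).coeff i = deriv (fun b => (P α b n).coeff i) a := by
  rw [derivP, Polynomial.finsetSum_coeff]
  simp only [Polynomial.coeff_C_mul_X_pow]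
  rw [Finset.sum_ite_eq]
  split_ifs with hi
  · rfl
  · rw [Finset.mem_range, not_lt] at hi
    rcases hi.eq_or_lt with rfl | hlt
    · simp only [coeff_P_self, deriv_const]
    · simp only [coeff_P_of_lt _ _ hlt, deriv_const]

theorem degree_derivP (α : ℝ) (n : ℕ) (a : ℝ) : (derivP α n a).degree < n := by
  rw [Polynomial.degree_lt_iff_coeff_zero]
  intro m hm
  rw [coeff_derivP]
  rcases hm.eq_or_lt with rfl | hlt
  · simp only [coeff_P_self, deriv_const]
  · simp only [coeff_P_of_lt _ _ hlt, deriv_const]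

theorem natDegree_derivP (α : ℝ) (n : ℕ) (a : ℝ) : (derivP α n a).natDegree < n + 1 :=
  Nat.lt_succ_of_le (Polynomial.natDegree_le_of_degree_le (degree_derivP α n a).le)

/-- Strong induction through the Gram-Schmidt formula, whose denominators h_k are positive. -/
theorem hasDerivAt_coeff_P {α : ℝ} (hα : 0 < α) {a : ℝ} (ha : a ∈ Set.Ioo (0 : ℝ) 1) (n : ℕ) :
    ∀ i, HasDerivAt (fun b => (P α b n).coeff i) ((derivP α n a).coeff i) a := by
  induction n using Nat.strong_induction_on with
  | _ n ih =>
    intro i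
    rw [coeff_derivP]
    refine DifferentiableAt.hasDerivAt ?_
    have heq : (fun b => (P α b n).coeff i) = fun b => (Polynomial.X ^ n : ℝ[X]).coeff i -
        ∑ k : Fin n, pairing α b (Polynomial.X ^ n) (P α b k) / pairing α b (P α b k) (P α b k) *
          (P α b k).coeff i := by
      funext b
      conv_lhs => rw [P_eq]
      rw [Polynomial.coeff_sub, Polynomial.finsetSum_coeff]
      simp only [Polynomial.coeff_C_mul]
    rw [heq]
    refine (differentiableAt_const _).sub (DifferentiableAt.fun_sum fun k _ => ?_)
    have hk : ∀ b, (P α b k).natDegree < n + 1 := fun b => by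
      rw [natDegree_P]; exact k.2.trans n.lt_succ_self
    have hk' : (derivP α k a).natDegree < n + 1 :=
      (natDegree_derivP α k a).trans (Nat.succ_lt_succ k.2)
    refine DifferentiableAt.mul (DifferentiableAt.div ?_ ?_ (h_pos hα k ha).ne')
      (ih k k.2 i).differentiableAt
    · exact (hasDerivAt_pairing_family hα ha (n + 1) (fun _ => Polynomial.X ^ n) (fun b => P α b k)
        0 (derivP α k a) (fun _ => by simp) hk (by simp) hk'
        (fun j => by simpa using hasDerivAt_const a _) (ih k k.2)).differentiableAt
    · exact (hasDerivAt_pairing_family hα ha (n + 1) (fun b => P α b k) (fun b => P α b k)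
        (derivP α k a) (derivP α k a) hk hk hk' hk' (ih k k.2) (ih k k.2)).differentiableAt

/-- Since P_n is monic, ∂ₐP_n has degree below n and is orthogonal to P_n; only the two equal
boundary terms survive. -/
theorem hasDerivAt_h {α : ℝ} (hα : 0 < α) {a : ℝ} (ha : a ∈ Set.Ioo (0 : ℝ) 1) (n : ℕ) :
    HasDerivAt (h α n) (-(2 * (1 - a ^ 2) ^ α * (P α a n).eval a ^ 2)) a := by
  have hn : ∀ b, (P α b n).natDegree < n + 1 := fun b => by
    rw [natDegree_P]; exact n.lt_succ_self
  have h1 := hasDerivAt_pairing_family hα ha (n + 1) (fun b => P α b n) (fun b => P α b n)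
    (derivP α n a) (derivP α n a) hn hn (natDegree_derivP α n a) (natDegree_derivP α n a)
    (hasDerivAt_coeff_P hα ha n) (hasDerivAt_coeff_P hα ha n)
  refine h1.congr_deriv ?_
  have hsq : ((-1 : ℝ) ^ n) * (-1) ^ n = 1 := by rw [← mul_pow]; norm_num
  rw [pairing_comm α a (P α a n), pairing_P_eq_zero_of_degree_lt hα ha n _ (degree_derivP α n a),
    eval_neg_P hα ha]
  linear_combination -(P α a n).eval a ^ 2 * (1 - a ^ 2) ^ α * hsq

/-- Obtained by differentiating ⟨P_n, P_k⟩ = 0 in a; the term with ∂ₐP_k vanishes by degree. -/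
theorem pairing_derivP {α : ℝ} (hα : 0 < α) {a : ℝ} (ha : a ∈ Set.Ioo (0 : ℝ) 1) {n k : ℕ}
    (hk : k < n) : pairing α a (derivP α n a) (P α a k) =
      ((P α a n).eval a * (P α a k).eval a + (P α a n).eval (-a) * (P α a k).eval (-a)) *
        (1 - a ^ 2) ^ α := by
  have hn : ∀ b, (P α b n).natDegree < n + 1 := fun b => by
    rw [natDegree_P]; exact n.lt_succ_self
  have hk1 : ∀ b, (P α b k).natDegree < n + 1 := fun b => by
    rw [natDegree_P]; exact hk.trans n.lt_succ_self
  have h1 := hasDerivAt_pairing_family hα ha (n + 1) (fun b => P α b n) (fun b => P α b k)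
    (derivP α n a) (derivP α k a) hn hk1 (natDegree_derivP α n a)
    ((natDegree_derivP α k a).trans (Nat.succ_lt_succ hk))
    (hasDerivAt_coeff_P hα ha n) (hasDerivAt_coeff_P hα ha k)
  have h2 : (fun b => pairing α b (P α b n) (P α b k)) =ᶠ[nhds a] fun _ => 0 := by
    filter_upwards [Ioo_mem_nhds ha.1 ha.2] with b hb
    exact pairing_P_of_lt hα hb n k hk
  have h3 := h1.unique ((hasDerivAt_const a (0 : ℝ)).congr_of_eventuallyEq h2)
  rw [pairing_comm α a (P α a n), pairing_P_eq_zero_of_degree_lt hα ha n _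
    ((degree_derivP α k a).trans (by exact_mod_cast hk))] at h3
  linarith

theorem eval_derivP {α : ℝ} (hα : 0 < α) {a : ℝ} (ha : a ∈ Set.Ioo (0 : ℝ) 1) (n : ℕ) (x : ℝ) :
    (derivP α n a).eval x = (1 - a ^ 2) ^ α * (P α a n).eval a *
      (kernel α a n x a + (-1) ^ n * kernel α a n x (-a)) := by
  rw [eval_eq_kernel_of_pairing hα ha n _ (degree_derivP α n a) ((1 - a ^ 2) ^ α * (P α a n).eval a) a (-a)
    ((1 - a ^ 2) ^ α * (-1) ^ n * (P α a n).eval a) ?_ x]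
  · ring
  · intro k hk
    rw [pairing_derivP hα ha hk, eval_neg_P hα ha n]
    ring

theorem hasDerivAt_eval_P {α : ℝ} (hα : 0 < α) {a : ℝ} (ha : a ∈ Set.Ioo (0 : ℝ) 1) (n : ℕ) :
    HasDerivAt (fun b => (P α b n).eval b)
      ((Polynomial.derivative (P α a n)).eval a + (derivP α n a).eval a) a := by
  have hn : ∀ b, (P α b n).natDegree < n + 1 := fun b => by
    rw [natDegree_P]; exact n.lt_succ_self
  -- The splitting P_n(b,b) = P_n(b,a) + (P_n(b,b) - P_n(b,a)) separates the two dependences on b;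
  -- the coefficients of the second part vanish at b = a.
  have h1 : HasDerivAt (fun b => ∑ i ∈ Finset.range (n + 1),
      ((P α b n).coeff i - (P α a n).coeff i) * b ^ i) _ a :=
    HasDerivAt.fun_sum fun i _ =>
      ((hasDerivAt_coeff_P hα ha n i).sub_const ((P α a n).coeff i)).mul (hasDerivAt_pow i a)
  have h2 := ((P α a n).hasDerivAt a).add h1
  refine (h2.congr_deriv ?_).congr_of_eventuallyEq (Filter.Eventually.of_forall fun b => ?_)
  · rw [Polynomial.eval_eq_sum_range' (natDegree_derivP α n a)]
    simp
  · change (P α b n).eval b = (P α a n).eval b + _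
    rw [Polynomial.eval_eq_sum_range' (hn b), Polynomial.eval_eq_sum_range' (hn a),
      ← Finset.sum_add_distrib]
    refine Finset.sum_congr rfl fun i _ => ?_
    ring

/-- The derivative of `P_n(a,a)`. -/
theorem hasDerivAt_eval_P_self {α : ℝ} (hα : 0 < α) {a : ℝ} (ha : a ∈ Set.Ioo (0 : ℝ) 1) (n : ℕ) :
    HasDerivAt (fun b => (P α b n).eval b)
      (((n + 1 + 2 * α) * a * (P α a n).eval a
          - (2 * n + 1 + 2 * α) * (P α a (n + 1)).eval a) / (1 - a ^ 2)
        + 2 * (1 - a ^ 2) ^ α * (P α a n).eval a / h α n a *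
          ((P α a n).eval a * (P α a (n + 1)).eval a / a - (P α a n).eval a ^ 2)) a := by
  refine (hasDerivAt_eval_P hα ha n).congr_deriv ?_
  have hu : 1 - a ^ 2 ≠ 0 := by nlinarith [ha.1, ha.2]
  have ha0 : a ≠ 0 := ha.1.ne'
  have h0 := (h_pos hα n ha).ne'
  have hsq : ((-1 : ℝ) ^ n) * (-1) ^ n = 1 := by rw [← mul_pow]; norm_num
  have h1 := structure_kernel hα ha n a
  have h2 := eval_derivP hα ha n a
  have h3 := kernel_succ α a n a a
  have h4 := kernel_succ α a n a (-a)
  have h5 := christoffel_darboux hα ha n a (-a)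
  rw [eval_neg_P hα ha] at h4 h5
  rw [eval_neg_P hα ha, pow_succ] at h5
  set p := (P α a n).eval a
  set q := (P α a (n + 1)).eval a
  have h6 : (-1) ^ n * kernel α a (n + 1) a (-a) = p * q / (a * h α n a) := by
    rw [eq_div_iff (mul_ne_zero ha0 h0)]
    linear_combination (1 / 2) * (-1) ^ n * h5 + p * q * hsq
  have h7 : (-1) ^ n * kernel α a n a (-a) = p * q / (a * h α n a) - p ^ 2 / h α n a := by
    linear_combination h6 - (-1) ^ n * h4 - p ^ 2 / h α n a * hsq
  have h8 : (Polynomial.derivative (P α a n)).eval a =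
      ((n + 1 + 2 * α) * a * p - (2 * n + 1 + 2 * α) * q) / (1 - a ^ 2) -
        (1 - a ^ 2) ^ α * p * (kernel α a (n + 1) a a - (-1) ^ n * kernel α a (n + 1) a (-a)) := by
    field_simp
    linear_combination h1
  -- The kernel on the diagonal, where Christoffel-Darboux gives no information, enters only as
  -- K_n(a,a) - K_{n+1}(a,a) = -P_n(a,a)²/h_n.
  rw [h8, h2, h3, mul_sub, mul_add, mul_add, h6, h7]
  field_simp
  ring

/-! ### Non-vanishing of P_n at 1 and at a. -/

/-- A monic nonconstant polynomial `d` with `d² ≤ c d` on the support of the weight does not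
divide `P_n`. -/
theorem P_ne_mul {α : ℝ} (hα : 0 < α) {a : ℝ} (ha : a ∈ Set.Ioo (0 : ℝ) 1) (n : ℕ)
    (d g : ℝ[X]) (hd : d.Monic) (hd1 : 0 < d.natDegree) (c : ℝ)
    (hc : ∀ x ∈ Set.Icc (-1 : ℝ) 1,
      d.eval x ^ 2 * weight α a x ≤ c * d.eval x * weight α a x) :
    P α a n ≠ d * g := by
  intro h
  have hg0 : g ≠ 0 := by
    rintro rfl
    exact (P_monic α a n).ne_zero (by rw [h, mul_zero])
  have hdeg : g.degree < n := by
    rw [← Polynomial.natDegree_lt_iff_degree_lt hg0]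
    have h1 := natDegree_P α a n
    rw [h, hd.natDegree_mul' hg0] at h1
    omega
  -- Multiplying the bound on d by g² and integrating gives h_n ≤ c⟨g, P_n⟩, which is 0 because g
  -- has lower degree.
  have h1 : pairing α a (P α a n) (P α a n) ≤ c * pairing α a g (P α a n) := by
    rw [← pairing_C_mul_left]
    refine intervalIntegral.integral_mono_on (by norm_num)
      (intervalIntegrable_mul_weight hα a _ _ _ _)
      (intervalIntegrable_mul_weight hα a _ _ _ _) fun x hx => ?_
    rw [h]
    simp only [Polynomial.eval_mul, Polynomial.eval_C]
    nlinarith [mul_le_mul_of_nonneg_left (hc x hx) (sq_nonneg (g.eval x))]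
  rw [pairing_P_eq_zero_of_degree_lt hα ha n g hdeg, mul_zero] at h1
  exact absurd (h_pos hα n ha) (not_lt.2 h1)

theorem eval_P_one_ne_zero {α : ℝ} (hα : 0 < α) {a : ℝ} (ha : a ∈ Set.Ioo (0 : ℝ) 1) (n : ℕ) :
    (P α a n).eval 1 ≠ 0 := by
  intro h
  obtain ⟨g, hg⟩ := Polynomial.dvd_iff_isRoot.2 h
  -- Here d = x - 1 takes values in [-2, 0], so d² ≤ -2d.
  refine P_ne_mul hα ha n _ g (Polynomial.monic_X_sub_C 1)
    (by rw [Polynomial.natDegree_X_sub_C]; exact one_pos) (-2)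
    (fun x hx => ?_) hg
  simp only [Polynomial.eval_sub, Polynomial.eval_X, Polynomial.eval_C]
  have hw : 0 ≤ weight α a x := by
    have h1 : (0 : ℝ) ≤ 1 - x ^ 2 := by nlinarith [hx.1, hx.2]
    refine mul_nonneg (Real.rpow_nonneg h1 _) ?_
    by_cases hx' : x ∈ Set.Ioo (-a) a <;> simp [hx']
  refine mul_le_mul_of_nonneg_right ?_ hw
  nlinarith [hx.1, hx.2]

theorem eval_P_self_ne_zero {α : ℝ} (hα : 0 < α) {a : ℝ} (ha : a ∈ Set.Ioo (0 : ℝ) 1) (n : ℕ) :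
    (P α a n).eval a ≠ 0 := by
  intro h
  obtain ⟨g, hg⟩ := Polynomial.dvd_iff_isRoot.2 h
  have h2 : (P α a n).eval (-a) = 0 := by rw [eval_neg_P hα ha, h, mul_zero]
  have h3 : g.IsRoot (-a) := by
    rw [hg] at h2
    simp only [Polynomial.eval_mul, Polynomial.eval_sub, Polynomial.eval_X, Polynomial.eval_C] at h2
    exact (mul_eq_zero.1 h2).resolve_left (by linarith [ha.1])
  obtain ⟨g', hg'⟩ := Polynomial.dvd_iff_isRoot.2 h3
  rw [hg', ← mul_assoc] at hg
  -- By parity -a is also a root, so d = x² - a², which lies in [0, 1] on the support; hence d² ≤ d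
  -- and c = 1.
  refine P_ne_mul hα ha n _ g' ((Polynomial.monic_X_sub_C a).mul (Polynomial.monic_X_sub_C (-a)))
    ?_ 1 (fun x hx => ?_) hg
  · rw [(Polynomial.monic_X_sub_C a).natDegree_mul (Polynomial.monic_X_sub_C (-a)),
      Polynomial.natDegree_X_sub_C]
    norm_num
  · simp only [Polynomial.eval_mul, Polynomial.eval_sub, Polynomial.eval_X, Polynomial.eval_C]
    by_cases hx' : x ∈ Set.Ioo (-a) a
    · simp [weight, hx']
    · have h0 : (0 : ℝ) ≤ 1 - x ^ 2 := by nlinarith [hx.1, hx.2]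
      have hax : a ^ 2 ≤ x ^ 2 := by
        by_contra hlt
        exact hx' (abs_lt.1 (abs_lt_of_sq_lt_sq (not_le.1 hlt) ha.1.le))
      have hw : 0 ≤ weight α a x := by
        refine mul_nonneg (Real.rpow_nonneg h0 _) ?_
        simp [hx']
      refine mul_le_mul_of_nonneg_right ?_ hw
      nlinarith [mul_nonneg (sub_nonneg.2 hax) (show 0 ≤ 1 - (x ^ 2 - a ^ 2) by nlinarith [ha.1])]

/-! ### The first-order system for R and S. -/

/-- The auxiliary quantity `S_n(a) = 2 P_n(a,a) P_{n+1}(a,a) (1 - a²)^α / h_n(a)`. -/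
def S (α : ℝ) (n : ℕ) (a : ℝ) : ℝ :=
  2 * (P α a n).eval a * (P α a (n + 1)).eval a * (1 - a ^ 2) ^ α / h α n a

theorem R_pos {α : ℝ} (hα : 0 < α) {a : ℝ} (ha : a ∈ Set.Ioo (0 : ℝ) 1) (n : ℕ) :
    0 < R α n a := by
  have hu : 0 < 1 - a ^ 2 := by nlinarith [ha.1, ha.2]
  have h1 := Real.rpow_pos_of_pos hu α
  have h2 := h_pos hα n ha
  have h3 := pow_pos (abs_pos.2 (eval_P_self_ne_zero hα ha n)) 2
  rw [sq_abs] at h3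
  unfold R
  positivity

/-- The algebraic relation between `R_n`, `S_n` and the recurrence coefficient, from the structure
relations of index `n` and `n + 1` at the endpoint `1`. -/
theorem recurrence_coeff_relation {α : ℝ} (hα : 0 < α) {a : ℝ} (ha : a ∈ Set.Ioo (0 : ℝ) 1)
    (n : ℕ) :
    (2 * n + 3 + 2 * α) * (h α (n + 1) a / h α n a) * (2 * n + 1 + 2 * α + a * R α n a) * R α n a =
      (n + 1 + 2 * α + S α n a) * (n + 1 + S α n a) * R α n a
        - a * S α n a ^ 2 * (2 * n + 1 + 2 * α + a * R α n a) := by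
  have hu : 1 - a ^ 2 ≠ 0 := by nlinarith [ha.1, ha.2]
  have h0 := (h_pos hα n ha).ne'
  have h1 := (h_pos hα (n + 1) ha).ne'
  have hx : (1 : ℝ) ^ 2 ≠ a ^ 2 := fun h => hu (by linarith)
  have hA := eval_P_one_ne_zero hα ha n
  have e1 := structure_relation hα ha n 1 hx
  have e2 := structure_relation hα ha (n + 1) 1 hx
  rw [P_add_two hα ha] at e2
  simp only [Polynomial.eval_mul, Polynomial.eval_X, Polynomial.eval_sub, Polynomial.eval_C] at e2
  unfold R S
  push_cast at e2
  set A := (P α a n).eval 1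
  set B := (P α a (n + 1)).eval 1
  set p := (P α a n).eval a
  set q := (P α a (n + 1)).eval a
  set W := (1 - a ^ 2) ^ α
  have f1 : (n + 1 + 2 * α + 2 * p * q * W / h α n a) * A =
      (2 * n + 1 + 2 * α + a * (2 * p ^ 2 * W / h α n a)) * B := by
    field_simp at e1 ⊢
    linear_combination -e1
  have f2 : (n + 1 + 2 * p * q * W / h α n a) * B =
      ((2 * n + 3 + 2 * α) * (h α (n + 1) a / h α n a) + a * (2 * q ^ 2 * W / h α n a)) * A := by
    field_simp at e2 ⊢
    refine mul_left_cancel₀ h1 ?_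
    linear_combination e2
  -- Compatibility of `f1` and `f2`. Multiplied by R, the remaining q² term becomes S², because R ·
  -- 2q²W/h_n = S².
  have f3 : (n + 1 + 2 * α + 2 * p * q * W / h α n a) * (n + 1 + 2 * p * q * W / h α n a) =
      (2 * n + 1 + 2 * α + a * (2 * p ^ 2 * W / h α n a)) *
      ((2 * n + 3 + 2 * α) * (h α (n + 1) a / h α n a) + a * (2 * q ^ 2 * W / h α n a)) := by
    refine mul_right_cancel₀ hA ?_
    linear_combination (n + 1 + 2 * p * q * W / h α n a) * f1 +
      (2 * n + 1 + 2 * α + a * (2 * p ^ 2 * W / h α n a)) * f2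
  linear_combination -(2 * p ^ 2 * W / h α n a) * f3

theorem hasDerivAt_one_sub_sq_rpow (α : ℝ) {a : ℝ} (ha : a ∈ Set.Ioo (0 : ℝ) 1) :
    HasDerivAt (fun b : ℝ => (1 - b ^ 2) ^ α) (-(2 * α * a) / (1 - a ^ 2) * (1 - a ^ 2) ^ α) a := by
  have hu : 1 - a ^ 2 ≠ 0 := by nlinarith [ha.1, ha.2]
  have h1 : HasDerivAt (fun x : ℝ => 1 - x ^ 2) (-(2 * a)) a := by
    simpa using ((hasDerivAt_pow 2 a).const_sub 1)
  refine (h1.rpow_const (p := α) (Or.inl hu)).congr_deriv ?_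
  rw [Real.rpow_sub_one hu]
  ring

theorem hasDerivAt_R {α : ℝ} (hα : 0 < α) {a : ℝ} (ha : a ∈ Set.Ioo (0 : ℝ) 1) (n : ℕ) :
    HasDerivAt (R α n) ((2 * (n + 1 + α) * a * R α n a - 2 * (2 * n + 1 + 2 * α) * S α n a) /
      (1 - a ^ 2) + 2 * S α n a * R α n a / a - R α n a ^ 2) a := by
  have hu : 1 - a ^ 2 ≠ 0 := by nlinarith [ha.1, ha.2]
  have ha0 : a ≠ 0 := ha.1.ne'
  have h0 := (h_pos hα n ha).ne'
  have h1 := ((((hasDerivAt_eval_P_self hα ha n).fun_pow 2).const_mul 2).fun_mul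
    (hasDerivAt_one_sub_sq_rpow α ha)).fun_div (hasDerivAt_h hα ha n) h0
  refine h1.congr_deriv ?_
  unfold R S
  set p := (P α a n).eval a
  set q := (P α a (n + 1)).eval a
  set W := (1 - a ^ 2) ^ α
  push_cast
  field_simp
  ring

/-- The recurrence removes P_{n+2}(a,a). The terms linear in S then cancel, as do the boundary terms
with those from h_n', and P_{n+1}(a,a)² is rewritten through S²/R. -/
theorem hasDerivAt_S {α : ℝ} (hα : 0 < α) {a : ℝ} (ha : a ∈ Set.Ioo (0 : ℝ) 1) (n : ℕ) :
    HasDerivAt (S α n) (((2 * n + 3 + 2 * α) * (h α (n + 1) a / h α n a) * R α n a -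
      (2 * n + 1 + 2 * α) * S α n a ^ 2 / R α n a) / (1 - a ^ 2)) a := by
  have hu : 1 - a ^ 2 ≠ 0 := by nlinarith [ha.1, ha.2]
  have ha0 : a ≠ 0 := ha.1.ne'
  have h0 := (h_pos hα n ha).ne'
  have hg := (h_pos hα (n + 1) ha).ne'
  have hp := eval_P_self_ne_zero hα ha n
  have hW := (Real.rpow_pos_of_pos (show 0 < 1 - a ^ 2 by nlinarith [ha.1, ha.2]) α).ne'
  have h1 := ((((hasDerivAt_eval_P_self hα ha n).const_mul 2).fun_mul
    (hasDerivAt_eval_P_self hα ha (n + 1))).fun_mul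
    (hasDerivAt_one_sub_sq_rpow α ha)).fun_div (hasDerivAt_h hα ha n) h0
  refine h1.congr_deriv ?_
  rw [P_add_two hα ha]
  simp only [Polynomial.eval_mul, Polynomial.eval_X, Polynomial.eval_sub, Polynomial.eval_C]
  unfold R S
  set p := (P α a n).eval a
  set q := (P α a (n + 1)).eval a
  set W := (1 - a ^ 2) ^ α
  push_cast
  field_simp
  ring

/-! ### Elimination and the final equation. -/

/-- Elimination of `S` from the first-order system satisfied by `(R, S)`. -/
theorem ode_of_first_order_system {α a n R s c R₁ s₁ R₂ : ℝ} (ha : a ≠ 0) (hu : 1 - a ^ 2 ≠ 0) (hR : R ≠ 0)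
    (hc : c * (2 * n + 1 + 2 * α + a * R) * R = (n + 1 + 2 * α + s) * (n + 1 + s) * R
      - a * s ^ 2 * (2 * n + 1 + 2 * α + a * R))
    (hR₁ : R₁ = (2 * (n + 1 + α) * a * R - 2 * (2 * n + 1 + 2 * α) * s) / (1 - a ^ 2)
      + 2 * s * R / a - R ^ 2)
    (hs₁ : s₁ = (c * R - (2 * n + 1 + 2 * α) * s ^ 2 / R) / (1 - a ^ 2))
    (hR₂ : R₂ = ((2 * (n + 1 + α) * (R + a * R₁) - 2 * (2 * n + 1 + 2 * α) * s₁) * (1 - a ^ 2)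
        + (2 * (n + 1 + α) * a * R - 2 * (2 * n + 1 + 2 * α) * s) * (2 * a)) / (1 - a ^ 2) ^ 2
      + ((2 * s₁ * R + 2 * s * R₁) * a - 2 * s * R) / a ^ 2 - 2 * R * R₁) :
    2 * a * (a ^ 2 - 1) ^ 2 * R * (a * R + 2 * n + 2 * α + 1) *
          ((a ^ 2 - 1) * R + (2 * n + 2 * α + 1) * a) * R₂
        - a * (a ^ 2 - 1) ^ 2 *
          (3 * a * (a ^ 2 - 1) * R ^ 2 + 2 * (2 * a ^ 2 - 1) * (2 * n + 2 * α + 1) * R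
            + (2 * n + 2 * α + 1) ^ 2 * a) * R₁ ^ 2
        + 2 * (a ^ 2 - 1) * (2 * n + 2 * α + 1) * R *
          ((2 * a ^ 4 - a ^ 2 + 1) * R + 2 * a ^ 3 * (2 * n + 2 * α + 1)) * R₁
        - a ^ 2 * (a ^ 2 - 1) ^ 3 * R ^ 6
        - 2 * a * (a ^ 2 - 1) ^ 2 * (2 * a ^ 2 - 1) * (2 * n + 2 * α + 1) * R ^ 5
        - (a ^ 2 - 1) *
          (a ^ 4 * (7 + 24 * α + 24 * n + 24 * n ^ 2 + 48 * n * α + 24 * α ^ 2)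
            - a ^ 2 * (5 + 24 * n + 24 * n ^ 2 + 24 * α + 48 * n * α + 20 * α ^ 2)
            + 2 + 4 * α + 4 * n + 4 * n ^ 2 + 8 * n * α) * R ^ 4
        - 4 * a * (a ^ 2 - 1) * (2 * n + 2 * α + 1) *
          (a ^ 2 * (2 * n + 2 * α + 1) ^ 2 - 2 * n - 2 * n ^ 2 - 2 * α - 4 * n * α) * R ^ 3
        - 4 * a ^ 2 * (2 * n + 2 * α + 1) ^ 2 *
          ((n * (n + 1) + (2 * n + 1) * α + α ^ 2) * a ^ 2 - n * (n + 1) - (2 * n + 1) * α)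
            * R ^ 2 = 0 := by
  have e1 : (1 - a ^ 2) * a * R₁ = (2 * (n + 1 + α) * a * R - 2 * (2 * n + 1 + 2 * α) * s) * a
      + (2 * s * R - a * R ^ 2) * (1 - a ^ 2) := by
    rw [hR₁]
    field_simp
    ring
  have e2 : (1 - a ^ 2) * R * s₁ = c * R ^ 2 - (2 * n + 1 + 2 * α) * s ^ 2 := by
    rw [hs₁]
    field_simp
  have e3 : (1 - a ^ 2) ^ 2 * a ^ 2 * R₂ =
      ((2 * (n + 1 + α) * (R + a * R₁) - 2 * (2 * n + 1 + 2 * α) * s₁) * (1 - a ^ 2)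
        + (2 * (n + 1 + α) * a * R - 2 * (2 * n + 1 + 2 * α) * s) * (2 * a)) * a ^ 2
      + ((2 * s₁ * R + 2 * s * R₁) * a - 2 * s * R - 2 * R * R₁ * a ^ 2) * (1 - a ^ 2) ^ 2 := by
    rw [hR₂]
    field_simp
    ring
  -- The extra factor a matches the a² that multiplies R₂ in `e3`.
  refine mul_left_cancel₀ ha ?_
  rw [mul_zero]
  -- Write L = (a²-1)R + Ma with M = 2n+1+2α. In `e3` the coefficient of s₁ is -2a(1-a²)L, which
  -- dictates the multiple of `e2`; its factor aR + M lets `hc` remove c. In the multiple of `e1`,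
  -- R₁² is removed as a difference of squares. A polynomial identity in a, n, α, R, s remains.
  -- Solving `e1` for s would require dividing by L; this is avoided.
  linear_combination (2 * R * (a * R + 2 * n + 2 * α + 1) *
      ((a ^ 2 - 1) * R + (2 * n + 2 * α + 1) * a)) * e3 +
    (2 * R * (a * R + 2 * n + 2 * α + 1) * ((a ^ 2 - 1) * R + (2 * n + 2 * α + 1) * a) *
        (2 * (n + 1 + α) * a ^ 2 + 2 * s * (1 - a ^ 2) - 2 * R * (1 - a ^ 2) * a) -
      (3 * a * (a ^ 2 - 1) * R ^ 2 + 2 * (2 * a ^ 2 - 1) * (2 * n + 2 * α + 1) * R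
            + (2 * n + 2 * α + 1) ^ 2 * a) * ((1 - a ^ 2) * a * R₁ +
        (2 * (n + 1 + α) * a * R - 2 * (2 * n + 1 + 2 * α) * s) * a
          + (2 * s * R - a * R ^ 2) * (1 - a ^ 2)) -
      2 * (2 * n + 2 * α + 1) * R *
        ((2 * a ^ 4 - a ^ 2 + 1) * R + 2 * a ^ 3 * (2 * n + 2 * α + 1))) * e1 -
    (4 * a * (a * R + 2 * n + 2 * α + 1) *
      ((a ^ 2 - 1) * R + (2 * n + 2 * α + 1) * a) ^ 2) * e2 -
    (4 * a * R * ((a ^ 2 - 1) * R + (2 * n + 2 * α + 1) * a) ^ 2) * hc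

end JacobiGap

end

theorem mainTheorem3 (α : ℝ) (hα : 0 < α) (n : ℕ) :
    let R : ℝ → ℝ := JacobiGap.R α n
    ∀ a ∈ Set.Ioo (0 : ℝ) 1,
      DifferentiableAt ℝ R a ∧ DifferentiableAt ℝ (deriv R) a ∧
      2 * a * (a ^ 2 - 1) ^ 2 * R a * (a * R a + 2 * n + 2 * α + 1) *
          ((a ^ 2 - 1) * R a + (2 * n + 2 * α + 1) * a) * deriv (deriv R) a
        - a * (a ^ 2 - 1) ^ 2 *
          (3 * a * (a ^ 2 - 1) * R a ^ 2 + 2 * (2 * a ^ 2 - 1) * (2 * n + 2 * α + 1) * R a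
            + (2 * n + 2 * α + 1) ^ 2 * a) * deriv R a ^ 2
        + 2 * (a ^ 2 - 1) * (2 * n + 2 * α + 1) * R a *
          ((2 * a ^ 4 - a ^ 2 + 1) * R a + 2 * a ^ 3 * (2 * n + 2 * α + 1)) * deriv R a
        - a ^ 2 * (a ^ 2 - 1) ^ 3 * R a ^ 6
        - 2 * a * (a ^ 2 - 1) ^ 2 * (2 * a ^ 2 - 1) * (2 * n + 2 * α + 1) * R a ^ 5
        - (a ^ 2 - 1) *
          (a ^ 4 * (7 + 24 * α + 24 * n + 24 * n ^ 2 + 48 * n * α + 24 * α ^ 2)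
            - a ^ 2 * (5 + 24 * n + 24 * n ^ 2 + 24 * α + 48 * n * α + 20 * α ^ 2)
            + 2 + 4 * α + 4 * n + 4 * n ^ 2 + 8 * n * α) * R a ^ 4
        - 4 * a * (a ^ 2 - 1) * (2 * n + 2 * α + 1) *
          (a ^ 2 * (2 * n + 2 * α + 1) ^ 2 - 2 * n - 2 * n ^ 2 - 2 * α - 4 * n * α) * R a ^ 3
        - 4 * a ^ 2 * (2 * n + 2 * α + 1) ^ 2 *
          ((n * (n + 1) + (2 * n + 1) * α + α ^ 2) * a ^ 2 - n * (n + 1) - (2 * n + 1) * α)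
            * R a ^ 2 = 0 := by
  intro R a ha
  have hu : 1 - a ^ 2 ≠ 0 := by nlinarith [ha.1, ha.2]
  have ha0 : a ≠ 0 := ha.1.ne'
  have hR := JacobiGap.hasDerivAt_R hα ha n
  have hS := JacobiGap.hasDerivAt_S hα ha n
  have hu' : HasDerivAt (fun b : ℝ => 1 - b ^ 2) (-(2 * a)) a := by
    simpa using ((hasDerivAt_pow 2 a).const_sub 1)
  -- The formula for R' holds on all of (0,1), so it may be differentiated again. It involves only R
  -- and S, so h_{n+1}/h_n is never differentiated.
  have heq : deriv R =ᶠ[nhds a] fun b =>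
      (2 * (n + 1 + α) * (b * R b) - 2 * (2 * n + 1 + 2 * α) * JacobiGap.S α n b) / (1 - b ^ 2)
        + 2 * (JacobiGap.S α n b * R b) / b - R b ^ 2 := by
    filter_upwards [Ioo_mem_nhds ha.1 ha.2] with b hb
    rw [(JacobiGap.hasDerivAt_R hα hb n).deriv]
    ring
  have hR2 := ((((((hasDerivAt_id' a).fun_mul hR).const_mul (2 * ((n : ℝ) + 1 + α))).fun_sub
    (hS.const_mul (2 * (2 * (n : ℝ) + 1 + 2 * α)))).fun_div hu' hu).fun_add
    (((hS.fun_mul hR).const_mul 2).fun_div (hasDerivAt_id' a) ha0)).fun_sub (hR.fun_pow 2)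
  have hR3 := hR2.congr_of_eventuallyEq heq
  refine ⟨hR.differentiableAt, hR3.differentiableAt, ?_⟩
  refine JacobiGap.ode_of_first_order_system ha0 hu (JacobiGap.R_pos hα ha n).ne'
    (JacobiGap.recurrence_coeff_relation hα ha n) hR.deriv hS.deriv ?_
  rw [hR3.deriv, hR.deriv, hS.deriv]
  push_cast
  ring
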